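/- Let $G$ be a finite group. For a finite-dimensional complex representation $V$ of $G$, let $\beta_{\mathrm{sep}}(G,V)$ be the minimal positive integer $d$ such that for all $v,w\in V$ with $Gv\neq Gw$ there is a homogeneous $G$-invariant polynomial function $f\in\mathbb{C}[V]^G$ of degree at most $d$ with $f(v)\neq f(w)$. The separating Noether number of $G$ is $$\beta_{\mathrm{sep}}(G):=\sup_V \beta_{\mathrm{sep}}(G,V),$$ where $V$ ranges over all finite-dimensional complex representations of $G$. Denote by $C_m$ the cyclic group of order $m$. **Theorem 1.1.** Let $\ell\ge 1$ and $n\ge 2$ be integers and let $p$ be the smallest prime divisor of $n$. Then $$\beta_{\mathrm{sep}}(C_{\ell n}\oplus C_n)=\ell n+\frac{n}{p}.$$ -/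

import Mathlib

universe u v

/-- `f : V → ℂ` is a homogeneous polynomial function of degree `d` on the complex vector space `V`:
it is given by a homogeneous polynomial of degree `d` in linear forms on `V`. -/
def IsHomogeneousPolyFun {V : Type v} [AddCommGroup V] [Module ℂ V] (d : ℕ) (f : V → ℂ) : Prop :=
  ∃ P : MvPolynomial (Module.Dual ℂ V) ℂ, P.IsHomogeneous d ∧
    ∀ x : V, f x = MvPolynomial.eval (fun φ : Module.Dual ℂ V => φ x) P

/-- The orbit `Gx` of a vector `x` under a representation of `G`. -/
def repOrbit {G : Type u} [Group G] {V : Type v} [AddCommGroup V] [Module ℂ V]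
    (ρ : Representation ℂ G V) (x : V) : Set V :=
  Set.range fun g : G => ρ g x

/-- `f` is constant along the `G`-orbits. -/
def IsInvariantFun {G : Type u} [Group G] {V : Type v} [AddCommGroup V] [Module ℂ V]
    (ρ : Representation ℂ G V) (f : V → ℂ) : Prop :=
  ∀ (g : G) (x : V), f (ρ g x) = f x

/-- Any two distinct orbits are separated by a homogeneous invariant of degree at most `d`. -/
def SeparatesOrbitsInDegree {G : Type u} [Group G] {V : Type v} [AddCommGroup V] [Module ℂ V]
    (ρ : Representation ℂ G V) (d : ℕ) : Prop :=
  ∀ x y : V, repOrbit ρ x ≠ repOrbit ρ y →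
    ∃ e : ℕ, e ≤ d ∧ ∃ f : V → ℂ, IsHomogeneousPolyFun e f ∧ IsInvariantFun ρ f ∧ f x ≠ f y

/-- `β_sep(G, V)`: the minimal positive integer `d` such that the homogeneous invariants of degree
at most `d` separate the orbits (`⊤` if there were no such `d`). -/
noncomputable def repSepNoetherNumber {G : Type u} [Group G] {V : Type v} [AddCommGroup V]
    [Module ℂ V] (ρ : Representation ℂ G V) : ℕ∞ :=
  ⨅ (d : ℕ) (_ : 0 < d) (_ : SeparatesOrbitsInDegree ρ d), (d : ℕ∞)

/-- `β_sep(G)`: the supremum of `β_sep(G, V)` over all finite-dimensional complex representations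
`V` of `G`. -/
noncomputable def sepNoetherNumber (G : Type u) [Group G] : ℕ∞ :=
  ⨆ (V : Type v) (_ : AddCommGroup V) (_ : Module ℂ V) (_ : FiniteDimensional ℂ V)
    (ρ : Representation ℂ G V), repSepNoetherNumber ρ

/-! ### Integer relations in abelian groups -/

/-! Write N = ln. Upper bound: pass to coordinates that are weight vectors. If all invariant
monomials of degree at most N + n/p in at most three coordinates agree at x and y, then x and y have
the same support, and the ratios u_i = y_i/x_i satisfy every short nonnegative relation among three
of the weights χ_i. It suffices to show that the u_i satisfy every integer relation of the χ_i:
duality then gives g with χ_i(g) = u_i, so gx = y (`exists_forall_character_apply_eq`).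

Two reductions lead there. Since the character group has two generators, localizing at each prime
shows that relations among three characters imply all others (`sum_smul_eq_zero_of_forall_triple`).
For three characters, short relations imply all integer ones
(`smul_add_smul_add_smul_eq_zero_of_forall_nat`): coefficients are reduced modulo N, and the
coefficient sums form a group dℤ with d ∣ N. The hard case n/p < d < N is settled by counting orders
in a group of order Nn (`exists_smul_add_smul_eq`).

Lower bound: for the weights (0,1), (1,0), (1,-n/p), every invariant monomial of degree below N +
n/p has its third exponent divisible by p, so (1,1,1) and (1,1,ζ), with ζ a primitive p-th root of
unity, are not separated. -/

lemma exists_forall_dvd_mul_of_prime {ι : Type*} [Finite ι] [Nonempty ι] {p : ℕ} (hp : p.Prime)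
    (z : ι → ℤ) : ∃ (j : ι) (m : ℤ), ¬ (p : ℤ) ∣ m ∧ ∀ k, z j ∣ m * z k := by
  have hp' : Prime (p : ℤ) := Nat.prime_iff_prime_int.mp hp
  obtain ⟨j, hj⟩ := Finite.exists_min fun k => emultiplicity (p : ℤ) (z k)
  by_cases h0 : z j = 0
  · refine ⟨j, 1, hp'.not_dvd_one, fun k => ?_⟩
    have hk := hj k
    rw [h0, emultiplicity_zero, top_le_iff, emultiplicity_eq_top] at hk
    have : z k = 0 := by
      by_contra hne
      exact hk (Int.finiteMultiplicity_iff.mpr ⟨by simpa using hp.ne_one, hne⟩)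
    simp [h0, this]
  · have hfin : FiniteMultiplicity (p : ℤ) (z j) :=
      Int.finiteMultiplicity_iff.mpr ⟨by simpa using hp.ne_one, h0⟩
    obtain ⟨m, hm, hpm⟩ := hfin.exists_eq_pow_mul_and_not_dvd
    refine ⟨j, m, hpm, fun k => ?_⟩
    have hk : (p : ℤ) ^ multiplicity (p : ℤ) (z j) ∣ z k :=
      pow_dvd_of_le_emultiplicity (by rw [← hfin.emultiplicity_eq_multiplicity]; exact hj k)
    rw [hm, mul_comm m]
    exact mul_dvd_mul_right hk m

/-- In an abelian group generated by two elements, every finite family is generated by two of its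
members, up to multiples prime to `p`. -/
lemma exists_pair_generating_of_prime {ι A : Type*} [Finite ι] [Nonempty ι] [AddCommGroup A]
    {p : ℕ} (hp : p.Prime) {e f : A} (hef : ∀ a : A, ∃ x y : ℤ, a = x • e + y • f) (v : ι → A) :
    ∃ (i j : ι) (m : ℤ), ¬ (p : ℤ) ∣ m ∧ ∀ k, ∃ c d : ℤ, m • v k = c • v i + d • v j := by
  choose x y hxy using fun k => hef (v k)
  -- Gaussian elimination localized at p: `i` is the pivot for the e-coordinates, `j` the pivot for
  -- the f-coordinates that remain.
  obtain ⟨i, m, hm, hi⟩ := exists_forall_dvd_mul_of_prime hp x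
  choose c hc using hi
  obtain ⟨j, m', hm', hj⟩ := exists_forall_dvd_mul_of_prime hp fun k => m * y k - c k * y i
  choose d hd using hj
  have key : ∀ k, m • v k - c k • v i = (m * y k - c k * y i) • f := fun k => by
    have := congrArg (· • e) (hc k)
    rw [hxy k, hxy i]
    linear_combination (norm := module) this
  refine ⟨i, j, m' * m, (Nat.prime_iff_prime_int.mp hp).not_dvd_mul hm' hm, fun k =>
    ⟨m' * c k - d k * c j, d k * m, ?_⟩⟩
  have h1 := congrArg (m' • ·) (key k)
  have h2 := congrArg (d k • ·) (key j)
  have h3 := congrArg (· • f) (hd k)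
  linear_combination (norm := module) h1 - h2 + h3

lemma eq_zero_of_forall_prime_exists_smul_eq_zero {U : Type*} [AddCommGroup U] {t : U}
    (h : ∀ p : ℕ, p.Prime → ∃ m : ℤ, ¬ (p : ℤ) ∣ m ∧ m • t = 0) : t = 0 := by
  by_contra ht
  have h1 : addOrderOf t ≠ 1 := fun h1 => ht (AddMonoid.addOrderOf_eq_one_iff.mp h1)
  -- Infinite order is included: then `addOrderOf t = 0`, and its `minFac` is the prime 2.
  obtain ⟨m, hm, hmt⟩ := h _ (Nat.minFac_prime h1)
  exact hm ((Int.natCast_dvd_natCast.mpr (Nat.minFac_dvd _)).trans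
    (addOrderOf_dvd_iff_zsmul_eq_zero.mpr hmt))

lemma smul_sum_smul_eq {ι B : Type*} [Fintype ι] [AddCommGroup B] {b : ι → B} {m : ℤ}
    {c d : ι → ℤ} {e f : B} (κ : ι → ℤ) (h : ∀ k, m • b k = c k • e + d k • f) :
    m • ∑ k, κ k • b k = (∑ k, κ k * c k) • e + (∑ k, κ k * d k) • f := by
  rw [Finset.smul_sum, Finset.sum_smul, Finset.sum_smul, ← Finset.sum_add_distrib]
  refine Finset.sum_congr rfl fun k _ => ?_
  rw [smul_comm, h k, smul_add, mul_smul, mul_smul]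

/-- A Helly type theorem: the relations of a finite family in an abelian group generated by two
elements are consequences of the relations involving at most three members. -/
lemma sum_smul_eq_zero_of_forall_triple {ι A U : Type*} [Fintype ι] [AddCommGroup A]
    [AddCommGroup U] {e f : A} (hef : ∀ a : A, ∃ x y : ℤ, a = x • e + y • f) (a : ι → A)
    (u : ι → U)
    (h : ∀ (i j k : ι) (x y z : ℤ), x • a i + y • a j + z • a k = 0 →
      x • u i + y • u j + z • u k = 0)
    (κ : ι → ℤ) (hκ : ∑ i, κ i • a i = 0) : ∑ i, κ i • u i = 0 := by
  cases isEmpty_or_nonempty ι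
  · simp
  refine eq_zero_of_forall_prime_exists_smul_eq_zero fun p hp => ?_
  obtain ⟨i, j, m, hm, hmv⟩ := exists_pair_generating_of_prime hp hef a
  choose c d hcd using hmv
  refine ⟨m, hm, ?_⟩
  -- The three-term hypothesis carries the p-local expression of `a k` through `a i` and `a j` over
  -- to `u`.
  have hu : ∀ k, m • u k = c k • u i + d k • u j := fun k => by
    have := h i j k (c k) (d k) (-m) (by rw [← hcd k]; simp)
    rw [neg_smul, add_neg_eq_zero] at this
    exact this.symm
  have ha := smul_sum_smul_eq κ hcd
  have hu' := smul_sum_smul_eq κ hu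
  rw [hκ, smul_zero] at ha
  rw [hu']
  simpa using h i j j _ _ 0 (by simpa using ha.symm)

/-! ### Zero-sum sequences over three elements -/

lemma addOrderOf_mul_card_quotient_zmultiples {A : Type*} [AddCommGroup A] (s : A) :
    addOrderOf s * Nat.card (A ⧸ AddSubgroup.zmultiples s) = Nat.card A := by
  rw [AddSubgroup.card_eq_card_quotient_mul_card_addSubgroup (AddSubgroup.zmultiples s),
    Nat.card_zmultiples, mul_comm]

/-- Lagrange along 0 ⊂ ⟨s⟩ ⊂ ⟨s, t⟩ ⊂ A: the hypothesis makes d divide the order of c in A/⟨s, t⟩.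
-/
lemma addOrderOf_mul_addOrderOf_mk_mul_dvd_card {A : Type*} [AddCommGroup A] {s t c : A} {d : ℕ}
    (h : ∀ (j : ℕ) (x y : ℤ), j • c = x • s + y • t → d ∣ j) :
    addOrderOf s * addOrderOf (t : A ⧸ AddSubgroup.zmultiples s) * d ∣ Nat.card A := by
  rw [← addOrderOf_mul_card_quotient_zmultiples s, mul_assoc]
  refine mul_dvd_mul_left _ ?_
  rw [← addOrderOf_mul_card_quotient_zmultiples (t : A ⧸ AddSubgroup.zmultiples s)]
  refine mul_dvd_mul_left _ (dvd_trans ?_ (addOrderOf_dvd_natCard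
    (((c : A ⧸ AddSubgroup.zmultiples s) : _ ⧸ AddSubgroup.zmultiples
      (t : A ⧸ AddSubgroup.zmultiples s)))))
  set j := addOrderOf (((c : A ⧸ AddSubgroup.zmultiples s) : _ ⧸ AddSubgroup.zmultiples
      (t : A ⧸ AddSubgroup.zmultiples s))) with hj
  have h1 := addOrderOf_nsmul_eq_zero (((c : A ⧸ AddSubgroup.zmultiples s) : _ ⧸
    AddSubgroup.zmultiples (t : A ⧸ AddSubgroup.zmultiples s)))
  rw [← hj, ← QuotientAddGroup.mk_nsmul, QuotientAddGroup.eq_zero_iff,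
    AddSubgroup.mem_zmultiples_iff] at h1
  obtain ⟨y, hy⟩ := h1
  rw [← QuotientAddGroup.mk_nsmul, ← QuotientAddGroup.mk_zsmul, QuotientAddGroup.eq,
    AddSubgroup.mem_zmultiples_iff] at hy
  obtain ⟨x, hx⟩ := hy
  exact h j x y (by rw [hx]; abel)

/-- Expanding (N - 2α)(N - 2β) ≥ 0 bounds αβ from below, whence d(2α + 2β - N) ≤ 2N. For d > 2 and a
sum above N + 2, the product (d - 2)(2α + 2β - N - 4) ≥ 0 contradicts this. -/
lemma add_add_le_of_mul_mul_le {α β d N : ℕ} (hα : 2 * α ≤ N) (hβ : 2 * β ≤ N) (hd : 2 * d ≤ N)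
    (h : 2 * (α * β * d) ≤ N * N) : α + β + d ≤ N + 2 := by
  zify at *
  by_contra! hlt
  have h1 : (0 : ℤ) ≤ (N - 2 * α) * (N - 2 * β) := mul_nonneg (by linarith) (by linarith)
  have h2 : (0 : ℤ) < d := by linarith
  have h3 : N * (d * (2 * α + 2 * β - N)) ≤ N * (2 * N : ℤ) := by
    nlinarith [mul_nonneg h2.le h1]
  have h4 : (d * (2 * α + 2 * β - N)) ≤ (2 * N : ℤ) := le_of_mul_le_mul_left h3 (by linarith)
  rcases le_or_gt (d : ℤ) 2 with h5 | h5
  · linarith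
  · nlinarith [mul_nonneg (show (0 : ℤ) ≤ d - 2 by linarith)
      (show (0 : ℤ) ≤ 2 * α + 2 * β - N - 4 by linarith)]

lemma le_div_of_dvd_of_lt {d n p : ℕ} (hp : IsLeast {q : ℕ | q.Prime ∧ q ∣ n} p) (hdn : d ∣ n)
    (hlt : d < n) : d ≤ n / p := by
  obtain ⟨e, rfl⟩ := hdn
  have he : e ≠ 1 := by rintro rfl; simp at hlt
  have he0 : 0 < e := Nat.pos_of_ne_zero (by rintro rfl; simp at hlt)
  have hpe : p ≤ e := (hp.2 ⟨Nat.minFac_prime he, (Nat.minFac_dvd e).trans (dvd_mul_left e d)⟩).trans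
    (Nat.minFac_le he0)
  rw [Nat.le_div_iff_mul_le hp.1.1.pos]
  exact Nat.mul_le_mul_left d hpe

lemma eq_one_of_mul_dvd {β d n p : ℕ} (hp : IsLeast {q : ℕ | q.Prime ∧ q ∣ n} p) (hn : 0 < n)
    (hdn : β * d ∣ n) (hlt : n / p < d) : β = 1 := by
  have hd : d ∣ n := (dvd_mul_left d β).trans hdn
  have : ¬ d < n := fun h => absurd (le_div_of_dvd_of_lt hp hd h) hlt.not_ge
  have hdeq : d = n := le_antisymm (Nat.le_of_dvd hn hd) (not_lt.mp this)
  subst hdeq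
  have := Nat.le_of_dvd hn hdn
  have h2 : β ≠ 0 := by rintro rfl; simp at hdn; omega
  nlinarith [Nat.pos_of_ne_zero h2]

lemma two_mul_le_of_dvd_of_ne {a N : ℕ} (hN : 0 < N) (h : a ∣ N) (hne : a ≠ N) : 2 * a ≤ N := by
  obtain ⟨k, rfl⟩ := h
  have : k ≠ 0 := by rintro rfl; simp at hN
  have : k ≠ 1 := by rintro rfl; simp at hne
  rw [mul_comm]
  exact Nat.mul_le_mul_left a (by omega)

section Pair

variable {A : Type*} [AddCommGroup A] {N n p d : ℕ} {s t c : A}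

/-- When s has the maximal order N, counting leaves βd ∣ n for the order β of t modulo ⟨s⟩. As d >
n/p, this forces d = n and β = 1, so t lies in ⟨s⟩. -/
lemma exists_smul_eq_of_addOrderOf_eq (hn : 0 < n) (hN : 0 < N) (hcard : Nat.card A = N * n)
    (hexp : ∀ a : A, N • a = 0) (hp : IsLeast {q : ℕ | q.Prime ∧ q ∣ n} p) (hdN : d ∣ N)
    (hpd : n / p < d) (h : ∀ (j : ℕ) (x y : ℤ), j • c = x • s + y • t → d ∣ j)
    (hd : ∃ x y : ℤ, d • c = x • s + y • t) (hs : addOrderOf s = N) :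
    ∃ x : ℕ, x + d ≤ N ∧ x • s = d • c := by
  have hdvd := addOrderOf_mul_addOrderOf_mk_mul_dvd_card h
  rw [hs, hcard, mul_assoc] at hdvd
  have hone := eq_one_of_mul_dvd hp hn (Nat.dvd_of_mul_dvd_mul_left hN hdvd) hpd
  rw [AddMonoid.addOrderOf_eq_one_iff, QuotientAddGroup.eq_zero_iff,
    AddSubgroup.mem_zmultiples_iff] at hone
  obtain ⟨k, rfl⟩ := hone
  obtain ⟨x, y, hxy⟩ := hd
  have hN' : (0 : ℤ) < N := by exact_mod_cast hN
  obtain ⟨z, hz⟩ := Int.eq_ofNat_of_zero_le (Int.emod_nonneg (x + y * k) hN'.ne')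
  have hzN : z < N := by have := Int.emod_lt_of_pos (x + y * k) hN'; omega
  have hzs : z • s = d • c := by
    rw [hxy, ← natCast_zsmul, ← hz, ← hs, mod_addOrderOf_zsmul, add_smul, mul_smul]
  obtain ⟨m, rfl⟩ := hdN
  have hm : 0 < m := Nat.pos_of_mul_pos_left hN
  -- Multiplying by m = N/d kills d • c, so N ∣ mz. Hence z < N improves to z ≤ N - d.
  have hdz : d ∣ z := by
    have : (m * z) • s = 0 := by rw [mul_smul, hzs, ← mul_smul, mul_comm m, hexp]
    have := addOrderOf_dvd_of_nsmul_eq_zero this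
    rw [hs, mul_comm] at this
    exact Nat.dvd_of_mul_dvd_mul_left hm this
  obtain ⟨r, rfl⟩ := hdz
  refine ⟨d * r, ?_, hzs⟩
  have : r < m := lt_of_mul_lt_mul_left hzN (Nat.zero_le d)
  nlinarith

/-- If s or t has order N, a single multiple suffices. Otherwise the orders and d are at most N/2,
and αβd ∣ Nn makes the box of reduced coefficients small enough. -/
lemma exists_smul_add_smul_eq [Finite A] (hn : 0 < n) (hN : 0 < N) (hnN : n ∣ N)
    (hcard : Nat.card A = N * n)
    (hexp : ∀ a : A, N • a = 0) (hp : IsLeast {q : ℕ | q.Prime ∧ q ∣ n} p) (hdN : d ∣ N)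
    (hlt : d < N)
    (hpd : n / p < d) (h : ∀ (j : ℕ) (x y : ℤ), j • c = x • s + y • t → d ∣ j)
    (hd : ∃ x y : ℤ, d • c = x • s + y • t) :
    ∃ x y : ℕ, x + y + d ≤ N ∧ x • s + y • t = d • c := by
  by_cases hs : addOrderOf s = N
  · obtain ⟨x, hx, hxs⟩ := exists_smul_eq_of_addOrderOf_eq hn hN hcard hexp hp hdN hpd h hd hs
    exact ⟨x, 0, by simpa using hx, by simpa using hxs⟩
  by_cases ht : addOrderOf t = N
  · obtain ⟨y, hy, hyt⟩ := exists_smul_eq_of_addOrderOf_eq (s := t) (t := s) hn hN hcard hexp hp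
      hdN hpd (fun j x y hj => h j y x (by rw [hj, add_comm]))
      (by obtain ⟨x, y, hxy⟩ := hd; exact ⟨y, x, by rw [hxy, add_comm]⟩) ht
    exact ⟨0, y, by simpa using hy, by simpa using hyt⟩
  have hdvd := addOrderOf_mul_addOrderOf_mk_mul_dvd_card h
  set α := addOrderOf s with hα
  set β := addOrderOf (t : A ⧸ AddSubgroup.zmultiples s) with hβ
  have hβt : β ∣ addOrderOf t := by
    rw [hβ, addOrderOf_dvd_iff_nsmul_eq_zero, ← QuotientAddGroup.mk_nsmul,
      addOrderOf_nsmul_eq_zero, QuotientAddGroup.mk_zero]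
  have hα2 : 2 * α ≤ N :=
    two_mul_le_of_dvd_of_ne hN (addOrderOf_dvd_of_nsmul_eq_zero (hexp s)) hs
  have hβ2 : 2 * β ≤ N := (Nat.mul_le_mul_left 2 (Nat.le_of_dvd (addOrderOf_pos t) hβt)).trans
    (two_mul_le_of_dvd_of_ne hN (addOrderOf_dvd_of_nsmul_eq_zero (hexp t)) ht)
  have hd2 : 2 * d ≤ N := two_mul_le_of_dvd_of_ne hN hdN hlt.ne
  -- If n = N, then d would be a proper divisor of n exceeding n/p.
  have hn2 : 2 * n ≤ N := two_mul_le_of_dvd_of_ne hN hnN fun hnN => by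
    subst hnN
    exact absurd (le_div_of_dvd_of_lt hp hdN hlt) hpd.not_ge
  have hprod : 2 * (α * β * d) ≤ N * N := by
    have := Nat.le_of_dvd (by rw [hcard]; positivity) hdvd
    rw [hcard] at this
    nlinarith
  have hsum := add_add_le_of_mul_mul_le hα2 hβ2 hd2 hprod
  have hα0 : 0 < α := addOrderOf_pos s
  have hβ0 : 0 < β := Nat.pos_of_dvd_of_pos hβt (addOrderOf_pos t)
  obtain ⟨X, Y, hXY⟩ := hd
  have hβt' : (β • t : A) ∈ AddSubgroup.zmultiples s := by
    rw [← QuotientAddGroup.eq_zero_iff, QuotientAddGroup.mk_nsmul, hβ, addOrderOf_nsmul_eq_zero]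
  obtain ⟨k, hk⟩ := AddSubgroup.mem_zmultiples_iff.mp hβt'
  have hα' : (0 : ℤ) < α := by exact_mod_cast hα0
  have hβ' : (0 : ℤ) < β := by exact_mod_cast hβ0
  obtain ⟨y, hy⟩ := Int.eq_ofNat_of_zero_le (Int.emod_nonneg Y hβ'.ne')
  obtain ⟨x, hx⟩ := Int.eq_ofNat_of_zero_le (Int.emod_nonneg (X + Y / β * k) hα'.ne')
  have hyβ : y < β := by have := Int.emod_lt_of_pos Y hβ'; omega
  have hxα : x < α := by have := Int.emod_lt_of_pos (X + Y / β * k) hα'; omega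
  -- Here x ≤ α - 1 and y ≤ β - 1, which absorbs the 2 in α + β + d ≤ N + 2.
  refine ⟨x, y, by omega, ?_⟩
  have h1 : (x : ℕ) • s = (X + Y / β * k) • s := by
    rw [← natCast_zsmul, ← hx, mod_addOrderOf_zsmul]
  have h2 : Y • t = (Y / β) • (k • s) + y • t := by
    rw [hk, ← natCast_zsmul t y, ← hy, ← natCast_zsmul t β, ← mul_smul, ← add_smul, mul_comm,
      Int.mul_ediv_add_emod]
  rw [h1, hXY, h2, add_smul, mul_smul, add_assoc]

end Pair

lemma toNat_emod_nsmul {B : Type*} [AddCommGroup B] {b : B} {N : ℕ} (hN : 0 < N) (hb : N • b = 0)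
    (x : ℤ) : (x % N).toNat • b = x • b := by
  rw [← natCast_zsmul, Int.toNat_of_nonneg (Int.emod_nonneg x (by exact_mod_cast hN.ne'))]
  conv_rhs => rw [← Int.emod_add_mul_ediv x N, add_smul, mul_comm, mul_smul, natCast_zsmul, hb,
    smul_zero, add_zero]

lemma emod_add_neg_emod_le {N : ℤ} (hN : 0 < N) (x : ℤ) : x % N + -x % N ≤ N := by
  have h1 := Int.emod_add_mul_ediv x N
  have h2 := Int.emod_add_mul_ediv (-x) N
  have h3 := Int.emod_lt_of_pos x hN
  have h4 := Int.emod_lt_of_pos (-x) hN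
  have h5 : -2 < x / N + -x / N := by
    by_contra! h
    nlinarith
  nlinarith [show -1 ≤ x / N + -x / N by omega]

/-- If `(u, v, w)` satisfies all relations of `(a, b, c)` with nonnegative coefficients of sum at
most `N + n / p`, then it satisfies all integer relations of `(a, b, c)`. -/
lemma smul_add_smul_add_smul_eq_zero_of_forall_nat {A U : Type*} [AddCommGroup A] [Finite A]
    [AddCommGroup U] {N n p : ℕ} (hn : 0 < n) (hN : 0 < N) (hnN : n ∣ N)
    (hcard : Nat.card A = N * n)
    (hexp : ∀ a : A, N • a = 0) (hp : IsLeast {q : ℕ | q.Prime ∧ q ∣ n} p) {a b c : A} {u v w : U}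
    (h : ∀ x y z : ℕ, x + y + z ≤ N + n / p → x • a + y • b + z • c = 0 →
      x • u + y • v + z • w = 0)
    (x y z : ℤ) (hxyz : x • a + y • b + z • c = 0) : x • u + y • v + z • w = 0 := by
  have hN' : (0 : ℤ) < N := by exact_mod_cast hN
  have hu : N • u = 0 := by simpa using h N 0 0 (Nat.le_add_right _ _) (by simp [hexp])
  have hv : N • v = 0 := by simpa using h 0 N 0 (by simp) (by simp [hexp])
  have hw : N • w = 0 := by simpa using h 0 0 N (by simp) (by simp [hexp])
  have small : ∀ x y z : ℤ, x • a + y • b + z • c = 0 → (x + y + z) % N ≤ (n / p : ℕ) →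
      x • u + y • v + z • w = 0 := by
    intro x y z hr hs
    have cast : ∀ x : ℤ, ((x % N).toNat : ℤ) = x % N := fun x =>
      Int.toNat_of_nonneg (Int.emod_nonneg x hN'.ne')
    have apply_h : ∀ x y z : ℤ, x • a + y • b + z • c = 0 →
        x % N + y % N + z % N ≤ N + (n / p : ℕ) → x • u + y • v + z • w = 0 := by
      intro x y z hr hs
      have := h (x % N).toNat (y % N).toNat (z % N).toNat
        (by zify; rw [cast, cast, cast]; exact_mod_cast hs)
        (by simpa only [toNat_emod_nsmul hN (hexp _)] using hr)
      simpa only [toNat_emod_nsmul hN hu, toNat_emod_nsmul hN hv, toNat_emod_nsmul hN hw] using this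
    by_cases hle : x % N + y % N + z % N ≤ N + (n / p : ℕ)
    · exact apply_h x y z hr hle
    -- The residue sum is congruent to r = (x + y + z) % N ≤ n/p, so beyond N + n/p it is at least
    -- 2N + r. The negated relation then has residue sum at most 3N - (2N + r) ≤ N.
    · have hneg := apply_h (-x) (-y) (-z)
        (by linear_combination (norm := module) (-1 : ℤ) • hr) ?_
      · linear_combination (norm := module) (-1 : ℤ) • hneg
      have hx := emod_add_neg_emod_le hN' x
      have hy := emod_add_neg_emod_le hN' y
      have hz := emod_add_neg_emod_le hN' z
      have h1 := Int.emod_add_mul_ediv x N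
      have h2 := Int.emod_add_mul_ediv y N
      have h3 := Int.emod_add_mul_ediv z N
      have h4 := Int.emod_add_mul_ediv (x + y + z) N
      have h5 : 1 < (x + y + z) / N - x / N - y / N - z / N := by
        by_contra! h
        nlinarith
      have h6 := mul_le_mul_of_nonneg_left (show 2 ≤ (x + y + z) / N - x / N - y / N - z / N by omega)
        hN'.le
      have h7 := Int.emod_nonneg (x + y + z) hN'.ne'
      have h8 := Int.natCast_nonneg (n / p)
      linarith
  -- The coefficient sums of all relations. One relation of sum d, its generator, reduces every
  -- other to sum 0, which `small` covers.
  let S : AddSubgroup ℤ :=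
    { carrier := {σ | ∃ x y z : ℤ, x • a + y • b + z • c = 0 ∧ x + y + z = σ}
      zero_mem' := ⟨0, 0, 0, by simp, by simp⟩
      add_mem' := by
        rintro _ _ ⟨x, y, z, h1, rfl⟩ ⟨x', y', z', h2, rfl⟩
        exact ⟨x + x', y + y', z + z', by linear_combination (norm := module) h1 + h2, by ring⟩
      neg_mem' := by
        rintro _ ⟨x, y, z, h1, rfl⟩
        exact ⟨-x, -y, -z, by linear_combination (norm := module) (-1 : ℤ) • h1, by ring⟩ }
  obtain ⟨d₀, hd₀⟩ := Int.subgroup_cyclic S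
  obtain ⟨d, hd⟩ : ∃ d : ℕ, ∀ σ : ℤ, σ ∈ S ↔ (d : ℤ) ∣ σ := by
    refine ⟨d₀.natAbs, fun σ => ?_⟩
    rw [hd₀, ← AddSubgroup.zmultiples_eq_closure, Int.mem_zmultiples_iff, Int.natAbs_dvd]
  have hdN : d ∣ N := by
    rw [← Int.natCast_dvd_natCast, ← hd]
    exact ⟨N, 0, 0, by simp [hexp], by simp⟩
  obtain ⟨x₀, y₀, z₀, h₀, hσ₀⟩ := (hd d).mpr dvd_rfl
  suffices hθ : x₀ • u + y₀ • v + z₀ • w = 0 by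
    obtain ⟨t, ht⟩ := (hd (x + y + z)).mp ⟨x, y, z, hxyz, rfl⟩
    have := small (x - t * x₀) (y - t * y₀) (z - t * z₀) (by linear_combination (norm := module) hxyz - t • h₀) (by
      rw [show x - t * x₀ + (y - t * y₀) + (z - t * z₀) = 0 by
        linear_combination ht - t * hσ₀, Int.zero_emod]
      exact Int.natCast_nonneg _)
    linear_combination (norm := module) this + t • hθ
  by_contra hθ
  have hpd : n / p < d := by
    by_contra! hle
    refine hθ (small _ _ _ h₀ ?_)
    rw [hσ₀]
    exact_mod_cast (Nat.mod_le d N).trans hle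
  have hlt : d < N := lt_of_le_of_ne (Nat.le_of_dvd hN hdN) fun heq => by
    refine hθ (small _ _ _ h₀ ?_)
    rw [hσ₀, heq, Int.emod_self]
    positivity
  -- This yields a nonnegative relation of sum N - d, which `h` covers. Adding it to the relation of
  -- sum d gives sum N, which `small` covers; the difference is the relation of sum d.
  obtain ⟨X, Y, hXY, hsum⟩ := exists_smul_add_smul_eq (s := a - c) (t := b - c) (c := c) hn hN hnN
    hcard hexp hp hdN hlt hpd
    (fun j x y hj => by
      rw [← Int.natCast_dvd_natCast, ← hd]
      refine ⟨-x, -y, j + x + y, ?_, by ring⟩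
      rw [← natCast_zsmul] at hj
      linear_combination (norm := module) hj)
    ⟨-x₀, -y₀, by
      rw [← natCast_zsmul, ← hσ₀]
      linear_combination (norm := module) h₀⟩
  obtain ⟨Z, hZ⟩ := Nat.exists_eq_add_of_le hXY
  have hc := hexp c
  rw [hZ] at hc
  have h1 : X • a + Y • b + Z • c = 0 := by
    linear_combination (norm := module) hsum + hc
  have h2 := h X Y Z (Nat.le_add_right_of_le (by omega)) h1
  have h3 := small (x₀ + X) (y₀ + Y) (z₀ + Z)
    (by linear_combination (norm := module) h₀ + h1) (by
      rw [show x₀ + X + (y₀ + Y) + (z₀ + Z) = (N : ℤ) by rw [hZ]; push_cast; linarith, Int.emod_self]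
      exact Int.natCast_nonneg _)
  exact hθ (by linear_combination (norm := module) h3 - h2)


/-! ### Characters of finite abelian groups -/

/-- The homomorphism from the free abelian group on `ι` given by the images of the generators. -/
def zpowProdHom {ι D : Type*} [Fintype ι] [CommGroup D] (a : ι → D) :
    Multiplicative (ι → ℤ) →* D where
  toFun k := ∏ i, a i ^ k.toAdd i
  map_one' := by simp
  map_mul' k k' := by simp [zpow_add, Finset.prod_mul_distrib]

lemma zpowProdHom_single {ι D : Type*} [Fintype ι] [DecidableEq ι] [CommGroup D] (a : ι → D)
    (i : ι) : zpowProdHom a (.ofAdd (Pi.single i 1)) = a i := by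
  simp only [zpowProdHom, MonoidHom.coe_mk, OneHom.coe_mk, toAdd_ofAdd]
  rw [Finset.prod_eq_single i (fun j _ hj => by simp [Pi.single_eq_of_ne hj]) (by simp)]
  simp

/-- Values prescribed on finitely many characters of a finite abelian group are attained at an
element as soon as they satisfy all the relations of these characters. -/
lemma exists_forall_character_apply_eq {G ι : Type*} [CommGroup G] [Finite G] [Fintype ι]
    (χ : ι → G →* ℂˣ) (u : ι → ℂˣ)
    (h : ∀ k : ι → ℤ, ∏ i, χ i ^ k i = 1 → ∏ i, u i ^ k i = 1) :
    ∃ g : G, ∀ i, χ i g = u i := by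
  classical
  let φ := zpowProdHom χ
  let ψ := zpowProdHom u
  have hker : φ.rangeRestrict.ker ≤ ψ.ker := fun k hk => by
    rw [MonoidHom.ker_rangeRestrict, MonoidHom.mem_ker] at hk
    exact h k.toAdd hk
  let ψ' := φ.rangeRestrict.liftOfSurjective φ.rangeRestrict_surjective ⟨ψ, hker⟩
  have hψ' : ∀ k, ψ' (φ.rangeRestrict k) = ψ k := fun k =>
    MonoidHom.liftOfRightInverse_comp_apply _ _ _ _ k
  have : HasEnoughRootsOfUnity ℂ (Monoid.exponent (G →* ℂˣ)) := by
    rw [Monoid.exponent_eq_of_mulEquiv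
      (CommGroup.monoidHom_mulEquiv_of_hasEnoughRootsOfUnity G ℂ).some]
    infer_instance
  -- The prescribed values define a character of the subgroup generated by the χ i. It extends to
  -- the whole dual group, and biduality makes the extension evaluation at some g.
  obtain ⟨η, hη⟩ := MonoidHom.domRestrict_surjective ℂ φ.range ψ'
  refine ⟨CommGroup.monoidHomMonoidHomEquiv G ℂ η, fun i => ?_⟩
  rw [CommGroup.apply_monoidHomMonoidHomEquiv]
  have h1 := hψ' (.ofAdd (Pi.single i 1))
  rw [zpowProdHom_single, ← hη] at h1
  rw [← h1]
  change _ = η (φ (.ofAdd (Pi.single i 1)))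
  rw [zpowProdHom_single]

/-- If the prescribed values satisfy the relations with nonnegative coefficients of sum at most
`N + n / p` between any three characters, then they satisfy all relations. -/
lemma prod_zpow_eq_one_of_forall_triple {ι A U : Type*} [Fintype ι] [CommGroup A] [Finite A]
    [CommGroup U] {N n p : ℕ} (hn : 0 < n) (hN : 0 < N) (hnN : n ∣ N)
    (hcard : Nat.card A = N * n) (hexp : ∀ a : A, a ^ N = 1)
    (hp : IsLeast {q : ℕ | q.Prime ∧ q ∣ n} p)
    {e f : A} (hef : ∀ a : A, ∃ x y : ℤ, a = e ^ x * f ^ y) (a : ι → A) (u : ι → U)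
    (h : ∀ (i j k : ι) (x y z : ℕ), x + y + z ≤ N + n / p → a i ^ x * a j ^ y * a k ^ z = 1 →
      u i ^ x * u j ^ y * u k ^ z = 1)
    (κ : ι → ℤ) (hκ : ∏ i, a i ^ κ i = 1) : ∏ i, u i ^ κ i = 1 := by
  have := sum_smul_eq_zero_of_forall_triple (A := Additive A) (U := Additive U)
    (e := .ofMul e) (f := .ofMul f) (fun b => hef b.toMul)
    (fun i => .ofMul (a i)) (fun i => .ofMul (u i))
    (fun i j k => smul_add_smul_add_smul_eq_zero_of_forall_nat (A := Additive A)
      (U := Additive U) hn hN hnN hcard hexp hp (h i j k)) κ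
  simp only [← ofMul_zpow, ← ofMul_prod, ofMul_eq_zero] at this
  exact this hκ

/-! ### Homogeneous invariants of degree at most `N + n / p` separate orbits -/

section Weight

variable {G V : Type*} [CommGroup G] [Fintype G] [AddCommGroup V] [Module ℂ V]

/-- The component of weight `χ` of a linear form, up to the factor `|G|`. -/
noncomputable def weightForm (ρ : Representation ℂ G V) (χ : G →* ℂˣ) (b : Module.Dual ℂ V) :
    Module.Dual ℂ V :=
  ∑ g : G, ((χ g)⁻¹ : ℂˣ).val • b ∘ₗ ρ g

lemma weightForm_apply (ρ : Representation ℂ G V) (χ : G →* ℂˣ) (b : Module.Dual ℂ V) (x : V) :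
    weightForm ρ χ b x = ∑ g : G, ((χ g)⁻¹ : ℂˣ).val * b (ρ g x) := by
  simp [weightForm, LinearMap.sum_apply]

lemma weightForm_apply_smul (ρ : Representation ℂ G V) (χ : G →* ℂˣ) (b : Module.Dual ℂ V) (h : G)
    (x : V) : weightForm ρ χ b (ρ h x) = χ h * weightForm ρ χ b x := by
  rw [weightForm_apply, weightForm_apply, Finset.mul_sum]
  refine Fintype.sum_equiv (Equiv.mulRight h) _ _ fun g => ?_
  simp only [Equiv.coe_mulRight, map_mul, mul_inv_rev, Units.val_mul, Module.End.mul_apply]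
  rw [← mul_assoc, ← mul_assoc, Units.mul_inv, one_mul]

lemma sum_character_inv_apply_eq_zero [Fintype (G →* ℂˣ)] {g : G} (hg : g ≠ 1) :
    ∑ χ : G →* ℂˣ, ((χ g)⁻¹ : ℂˣ).val = 0 := by
  obtain ⟨φ, hφ⟩ := CommGroup.exists_apply_ne_one_of_hasEnoughRootsOfUnity G ℂ
    (inv_ne_one.mpr hg)
  have := sum_hom_units_eq_zero ((Units.coeHom ℂ).comp (MonoidHom.eval (M := G) (N := ℂˣ) g⁻¹))
    fun h => hφ (Units.ext (by simpa using DFunLike.congr_fun h φ))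
  simpa using this

/-- Orthogonality of characters leaves only g = 1. Each form is thus recovered from its weight
components, so these separate points. -/
lemma sum_weightForm_apply [Fintype (G →* ℂˣ)] (ρ : Representation ℂ G V) (b : Module.Dual ℂ V)
    (x : V) : ∑ χ : G →* ℂˣ, weightForm ρ χ b x = Fintype.card (G →* ℂˣ) * b x := by
  simp only [weightForm_apply]
  rw [Finset.sum_comm, Finset.sum_eq_single 1]
  · simp
  · intro g _ hg
    rw [← Finset.sum_mul, sum_character_inv_apply_eq_zero hg, zero_mul]
  · simp

end Weight

lemma repOrbit_apply {G V : Type*} [Group G] [AddCommGroup V] [Module ℂ V]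
    (ρ : Representation ℂ G V) (g : G) (x : V) : repOrbit ρ (ρ g x) = repOrbit ρ x := by
  ext y
  constructor
  · rintro ⟨h, rfl⟩
    exact ⟨h * g, by simp⟩
  · rintro ⟨h, rfl⟩
    exact ⟨h * g⁻¹, by simp⟩

lemma isHomogeneousPolyFun_mul_pow {V : Type*} [AddCommGroup V] [Module ℂ V]
    (b₁ b₂ b₃ : Module.Dual ℂ V) (m₁ m₂ m₃ : ℕ) :
    IsHomogeneousPolyFun (m₁ + m₂ + m₃) fun x => b₁ x ^ m₁ * b₂ x ^ m₂ * b₃ x ^ m₃ := by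
  refine ⟨MvPolynomial.X b₁ ^ m₁ * MvPolynomial.X b₂ ^ m₂ * MvPolynomial.X b₃ ^ m₃, ?_,
    fun x => ?_⟩
  · exact ((MvPolynomial.isHomogeneous_X_pow _ _).mul (MvPolynomial.isHomogeneous_X_pow _ _)).mul
      (MvPolynomial.isHomogeneous_X_pow _ _)
  · simp only [map_mul, map_pow, MvPolynomial.eval_X]

lemma separatesOrbitsInDegree_add_div {G V : Type*} [CommGroup G] [Finite G] [AddCommGroup V]
    [Module ℂ V] [FiniteDimensional ℂ V] {N n p : ℕ} (hn : 0 < n) (hN : 0 < N) (hnN : n ∣ N)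
    (hcard : Nat.card G = N * n) (hexp : ∀ g : G, g ^ N = 1)
    (hp : IsLeast {q : ℕ | q.Prime ∧ q ∣ n} p)
    {e f : G →* ℂˣ} (hef : ∀ χ : G →* ℂˣ, ∃ x y : ℤ, χ = e ^ x * f ^ y)
    (ρ : Representation ℂ G V) : SeparatesOrbitsInDegree ρ (N + n / p) := by
  classical
  have := Fintype.ofFinite G
  have := Fintype.ofFinite (G →* ℂˣ)
  intro x y hne
  by_contra! hcon
  let B := Module.finBasis ℂ V
  let X : Fin (Module.finrank ℂ V) × (G →* ℂˣ) → Module.Dual ℂ V := fun i =>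
    weightForm ρ i.2 (B.coord i.1)
  have hX : ∀ i (g : G) (z : V), X i (ρ g z) = i.2 g * X i z := fun i g z =>
    weightForm_apply_smul ρ i.2 _ g z
  have hsep : ∀ z z' : V, (∀ i, X i z = X i z') → z = z' := by
    intro z z' h
    refine B.ext_elem fun i => ?_
    have h1 : ∑ χ, weightForm ρ χ (B.coord i) z = ∑ χ, weightForm ρ χ (B.coord i) z' :=
      Finset.sum_congr rfl fun χ _ => h (i, χ)
    rw [sum_weightForm_apply, sum_weightForm_apply] at h1
    exact mul_left_cancel₀ (by simp) h1
  have hmono : ∀ i j k (a b c : ℕ), a + b + c ≤ N + n / p → i.2 ^ a * j.2 ^ b * k.2 ^ c = 1 →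
      X i x ^ a * X j x ^ b * X k x ^ c = X i y ^ a * X j y ^ b * X k y ^ c := by
    intro i j k a b c hle h1
    refine hcon _ hle _ (isHomogeneousPolyFun_mul_pow _ _ _ _ _ _) fun g z => ?_
    have h2 := congrArg Units.val (DFunLike.congr_fun h1 g)
    simp only [MonoidHom.mul_apply, MonoidHom.pow_apply, Units.val_mul, Units.val_pow_eq_pow_val,
      MonoidHom.one_apply, Units.val_one] at h2
    simp only [hX]
    linear_combination (X i z ^ a * X j z ^ b * X k z ^ c) * h2
  have hexp' : ∀ χ : G →* ℂˣ, χ ^ N = 1 := fun χ => by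
    ext g
    rw [MonoidHom.pow_apply, ← map_pow, hexp, map_one, MonoidHom.one_apply]
  -- The N-th power of each weight form is invariant of admissible degree, so x and y have the same
  -- support.
  have hzero : ∀ i, X i x = 0 ↔ X i y = 0 := fun i => by
    have := hmono i i i N 0 0 (by simp) (by rw [hexp']; ext; simp)
    simp only [pow_zero, mul_one] at this
    rw [← pow_eq_zero_iff hN.ne', this, pow_eq_zero_iff hN.ne']
  let S := {i // X i x ≠ 0}
  obtain ⟨g, hg⟩ := exists_forall_character_apply_eq (fun i : S => i.1.2)
    (fun i : S => Units.mk0 (X i.1 y / X i.1 x) (div_ne_zero (mt (hzero _).mpr i.2) i.2))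
    (prod_zpow_eq_one_of_forall_triple hn hN hnN
      ((CommGroup.card_monoidHom_of_hasEnoughRootsOfUnity G ℂ).trans hcard) hexp' hp hef
      (fun i : S => i.1.2)
      (fun i : S => Units.mk0 (X i.1 y / X i.1 x) (div_ne_zero (mt (hzero _).mpr i.2) i.2))
      fun i j k a b c hle h1 => by
        have := hmono _ _ _ a b c hle h1
        ext
        simp only [Units.val_mul, Units.val_pow_eq_pow_val, Units.val_mk0, div_pow, Units.val_one]
        rw [div_mul_div_comm, div_mul_div_comm, ← this, div_self]
        exact mul_ne_zero (mul_ne_zero (pow_ne_zero _ i.2) (pow_ne_zero _ j.2))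
          (pow_ne_zero _ k.2))
  refine hne ?_
  rw [← hsep (ρ g x) y fun i => ?_, repOrbit_apply]
  rw [hX]
  by_cases hi : X i x = 0
  · rw [hi, (hzero i).mp hi, mul_zero]
  · have := congrArg Units.val (hg ⟨i, hi⟩)
    simp only [Units.val_mk0] at this
    rw [this, div_mul_cancel₀ _ hi]

/-! ### Diagonal representations -/

section Diagonal

variable {G ι : Type*} [CommGroup G]

/-- The representation on `ι → ℂ` on which the `i`-th coordinate has weight `χ i`. -/
def diagonalRep (χ : ι → G →* ℂˣ) : Representation ℂ G (ι → ℂ) where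
  toFun g := LinearMap.pi fun i => (χ i g).val • LinearMap.proj i
  map_one' := by ext; simp
  map_mul' g h := by
    refine LinearMap.ext fun x => funext fun i => ?_
    simp [mul_assoc]

lemma diagonalRep_apply (χ : ι → G →* ℂˣ) (g : G) (x : ι → ℂ) (i : ι) :
    diagonalRep χ g x i = χ i g * x i := by
  simp [diagonalRep]

lemma exists_eval_eq_of_isHomogeneousPolyFun [Fintype ι] {e : ℕ} {f : (ι → ℂ) → ℂ}
    (hf : IsHomogeneousPolyFun e f) :
    ∃ P : MvPolynomial ι ℂ, P.IsHomogeneous e ∧ ∀ x, f x = MvPolynomial.eval x P := by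
  classical
  obtain ⟨P, hP, hfP⟩ := hf
  let L : Module.Dual ℂ (ι → ℂ) → MvPolynomial ι ℂ := fun φ =>
    ∑ i, MvPolynomial.C (φ (Pi.single i 1)) * MvPolynomial.X i
  refine ⟨MvPolynomial.aeval L P, ?_, fun x => ?_⟩
  · simpa using hP.aeval L fun φ => MvPolynomial.IsHomogeneous.sum _ _ _ fun i _ =>
      MvPolynomial.isHomogeneous_C_mul_X _ _
  · rw [hfP, ← MvPolynomial.coe_aeval_eq_eval, ← MvPolynomial.coe_aeval_eq_eval]
    change _ = MvPolynomial.aeval x (MvPolynomial.aeval L P)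
    rw [← AlgHom.comp_apply, MvPolynomial.comp_aeval]
    have hL : (fun φ : Module.Dual ℂ (ι → ℂ) => φ x) = fun φ => MvPolynomial.aeval x (L φ) := by
      funext φ
      simp only [L, map_sum, map_mul, MvPolynomial.aeval_X, MvPolynomial.aeval_C]
      rw [LinearMap.pi_apply_eq_sum_univ φ x]
      refine Finset.sum_congr rfl fun i _ => ?_
      rw [smul_eq_mul, mul_comm]
      congr 1
      rw [Algebra.algebraMap_self_apply]
      congr 1
      funext j
      simp [Pi.single_apply, eq_comm]
    rw [hL]
    rfl

/-- Two vectors on which all invariant monomials of degree `e` agree are not separated by the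
homogeneous invariants of degree `e`. -/
lemma eq_of_isInvariantFun_diagonalRep [Finite G] [Fintype ι] (χ : ι → G →* ℂˣ) {e : ℕ}
    {f : (ι → ℂ) → ℂ} (hf : IsHomogeneousPolyFun e f) (hinv : IsInvariantFun (diagonalRep χ) f)
    {x y : ι → ℂ} (hxy : ∀ m : ι → ℕ, ∑ i, m i = e → ∏ i, χ i ^ m i = 1 →
      ∏ i, x i ^ m i = ∏ i, y i ^ m i) : f x = f y := by
  classical
  have := Fintype.ofFinite G
  obtain ⟨P, hP, hfP⟩ := exists_eval_eq_of_isHomogeneousPolyFun hf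
  -- Averaging over G annihilates every monomial of nontrivial weight.
  have avg : ∀ z, (Fintype.card G : ℂ) * f z =
      ∑ m ∈ P.support, P.coeff m * ((∑ g : G, ((∏ i, χ i ^ m i) g).val) * ∏ i, z i ^ m i) := by
    intro z
    have h1 : (Fintype.card G : ℂ) * f z = ∑ g : G, f (diagonalRep χ g z) := by
      simp [hinv _ z]
    rw [h1]
    simp only [hfP, MvPolynomial.eval_eq', diagonalRep_apply]
    rw [Finset.sum_comm]
    refine Finset.sum_congr rfl fun m _ => ?_
    rw [Finset.sum_mul, Finset.mul_sum]
    refine Finset.sum_congr rfl fun g _ => ?_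
    simp [mul_pow, Finset.prod_mul_distrib, MonoidHom.finsetProd_apply]
  have hG : (Fintype.card G : ℂ) ≠ 0 := by simp
  refine mul_left_cancel₀ hG ?_
  rw [avg, avg]
  refine Finset.sum_congr rfl fun m hm => ?_
  by_cases hχ : ∏ i, χ i ^ m i = 1
  · rw [hxy m ?_ hχ]
    rw [hP.degree_eq_sum_deg_support hm]
    exact (Finset.sum_subset (Finset.subset_univ _) fun i _ hi => by simpa using hi).symm
  · have := sum_hom_units_eq_zero ((Units.coeHom ℂ).comp (∏ i, χ i ^ m i)) fun h => hχ <| by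
      ext g
      simpa using DFunLike.congr_fun h g
    simp only [MonoidHom.comp_apply, Units.coeHom_apply] at this
    rw [this, zero_mul, zero_mul]

end Diagonal

/-! ### A representation with large separating degree -/

section LowerBound

variable {N n : ℕ} [NeZero N] [NeZero n]

/-- The character `(a, b) ↦ exp (2πi s a / N) exp (2πi r b / n)`. -/
noncomputable def torusCharacter (s : ZMod N) (r : ZMod n) :
    Multiplicative (ZMod N) × Multiplicative (ZMod n) →* ℂˣ :=
  MonoidHom.toHomUnits
    { toFun := fun g => ZMod.stdAddChar (s * g.1.toAdd) * ZMod.stdAddChar (r * g.2.toAdd)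
      map_one' := by simp
      map_mul' := fun g h => by
        simp only [Prod.fst_mul, Prod.snd_mul, toAdd_mul, mul_add, AddChar.map_add_eq_mul]
        ring }

lemma torusCharacter_apply (s : ZMod N) (r : ZMod n)
    (g : Multiplicative (ZMod N) × Multiplicative (ZMod n)) :
    (torusCharacter s r g : ℂ) =
      ZMod.stdAddChar (s * g.1.toAdd) * ZMod.stdAddChar (r * g.2.toAdd) := rfl

lemma torusCharacter_eq_one_iff {s : ZMod N} {r : ZMod n} :
    torusCharacter s r = 1 ↔ s = 0 ∧ r = 0 := by
  constructor
  · intro h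
    have h1 := congrArg Units.val (DFunLike.congr_fun h (.ofAdd 1, 1))
    have h2 := congrArg Units.val (DFunLike.congr_fun h (1, .ofAdd 1))
    rw [torusCharacter_apply] at h1 h2
    simp only [toAdd_ofAdd, toAdd_one, mul_one, mul_zero, AddChar.map_zero_eq_one, one_mul,
      MonoidHom.one_apply, Units.val_one] at h1 h2
    rw [← AddChar.map_zero_eq_one (ZMod.stdAddChar (N := N))] at h1
    rw [← AddChar.map_zero_eq_one (ZMod.stdAddChar (N := n))] at h2
    exact ⟨ZMod.injective_stdAddChar h1, ZMod.injective_stdAddChar h2⟩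
  · rintro ⟨rfl, rfl⟩
    ext g
    simp [torusCharacter_apply]

lemma torusCharacter_mul (s s' : ZMod N) (r r' : ZMod n) :
    torusCharacter s r * torusCharacter s' r' = torusCharacter (s + s') (r + r') := by
  ext g
  simp only [MonoidHom.mul_apply, Units.val_mul, torusCharacter_apply, add_mul,
    AddChar.map_add_eq_mul]
  ring

lemma torusCharacter_pow (s : ZMod N) (r : ZMod n) (m : ℕ) :
    torusCharacter s r ^ m = torusCharacter ((m : ZMod N) * s) ((m : ZMod n) * r) := by
  ext g
  rw [MonoidHom.pow_apply, Units.val_pow_eq_pow_val, torusCharacter_apply, torusCharacter_apply,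
    mul_assoc, mul_assoc, ← nsmul_eq_mul, ← nsmul_eq_mul, AddChar.map_nsmul_eq_pow,
    AddChar.map_nsmul_eq_pow, mul_pow]

/-- The weights `(0, 1), (1, 0), (1, -n / p)` of `ZMod N × ZMod n`. -/
noncomputable def extremalWeight (N n p : ℕ) [NeZero N] [NeZero n] :
    Fin 3 → Multiplicative (ZMod N) × Multiplicative (ZMod n) →* ℂˣ :=
  ![torusCharacter 0 1, torusCharacter 1 0, torusCharacter 1 (-(n / p : ℕ))]

/-- Put q = n/p. Invariance means N ∣ m₁ + m₂ and n ∣ m₀ - m₂q. If p ∤ m₂, then m₁ + m₂ ≥ N leaves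
m₀ < q; as q ∣ m₀, this gives m₀ = 0, so pq ∣ m₂q, a contradiction. -/
lemma prime_dvd_of_prod_extremalWeight_pow_eq_one {p : ℕ} (hp : p.Prime) (hpn : p ∣ n)
    {m : Fin 3 → ℕ} (hm : ∏ i, extremalWeight N n p i ^ m i = 1)
    (hlt : ∑ i, m i < N + n / p) : p ∣ m 2 := by
  simp only [Fin.prod_univ_three, extremalWeight, Matrix.cons_val_zero, Matrix.cons_val_one,
    Matrix.cons_val, torusCharacter_pow, torusCharacter_mul,
    torusCharacter_eq_one_iff] at hm
  rw [Fin.sum_univ_three] at hlt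
  obtain ⟨h1, h2⟩ := hm
  obtain ⟨q, rfl⟩ := hpn
  rw [Nat.mul_div_cancel_left _ hp.pos] at hlt h2
  have hN : N ∣ m 1 + m 2 := by
    rw [← ZMod.natCast_eq_zero_iff]
    push_cast
    simpa using h1
  have hn : ((p * q : ℕ) : ℤ) ∣ m 0 - m 2 * q := by
    rw [← ZMod.intCast_zmod_eq_zero_iff_dvd]
    push_cast
    linear_combination h2
  have hq : 0 < q := Nat.pos_of_ne_zero fun h => NeZero.ne (p * q) (by simp [h])
  by_contra hpm
  have hle : N ≤ m 1 + m 2 := Nat.le_of_dvd (Nat.pos_of_ne_zero fun h => hpm (by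
    rw [show m 2 = 0 by omega]; exact dvd_zero p)) hN
  have hqm : q ∣ m 0 := by
    rw [← Int.natCast_dvd_natCast]
    have : (q : ℤ) ∣ m 0 - m 2 * q := dvd_trans (by push_cast; exact dvd_mul_left _ _) hn
    simpa using (dvd_sub_left (dvd_mul_left (q : ℤ) (m 2))).mp this
  have h0 : m 0 = 0 := Nat.eq_zero_of_dvd_of_lt hqm (by omega)
  rw [h0] at hn
  refine hpm (Nat.dvd_of_mul_dvd_mul_right hq ?_)
  rw [← Int.natCast_dvd_natCast]
  push_cast at hn ⊢
  simpa using hn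

lemma not_separatesOrbitsInDegree_diagonalRep_extremalWeight {p : ℕ} (hp : p.Prime) (hpn : p ∣ n)
    {d : ℕ} (hd : d < N + n / p) :
    ¬ SeparatesOrbitsInDegree
      (diagonalRep fun i : ULift.{v} (Fin 3) => extremalWeight N n p i.down) d := by
  intro hsep
  have : NeZero p := ⟨hp.ne_zero⟩
  obtain ⟨ζ, hζ⟩ := HasEnoughRootsOfUnity.exists_primitiveRoot ℂ p
  let y : ULift.{v} (Fin 3) → ℂ := fun i => ![1, 1, ζ] i.down
  obtain ⟨e, he, f, hf, hinv, hne⟩ := hsep 1 y fun horb => by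
    have hy : y ∈ repOrbit (diagonalRep fun i : ULift.{v} (Fin 3) =>
        extremalWeight N n p i.down) 1 := by
      rw [horb]
      exact ⟨1, by simp⟩
    obtain ⟨g, hg⟩ := hy
    have h0 := congrFun hg ⟨0⟩
    have h1 := congrFun hg ⟨1⟩
    have h2 := congrFun hg ⟨2⟩
    simp only [diagonalRep_apply, extremalWeight, torusCharacter_apply, y, Pi.one_apply, mul_one,
      Matrix.cons_val_zero, Matrix.cons_val_one, Matrix.cons_val, zero_mul, one_mul,
      AddChar.map_zero_eq_one] at h0 h1 h2
    -- Fixing the first two coordinates makes g act trivially on the third as well, which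
    -- contradicts ζ ≠ 1.
    rw [← AddChar.map_zero_eq_one (ZMod.stdAddChar (N := n))] at h0
    rw [ZMod.injective_stdAddChar h0, h1, mul_zero, AddChar.map_zero_eq_one, mul_one] at h2
    exact hζ.ne_one hp.one_lt h2.symm
  refine hne (eq_of_isInvariantFun_diagonalRep _ hf hinv fun m hm hχ => ?_)
  rw [← Equiv.ulift.symm.prod_comp] at hχ
  rw [← Equiv.ulift.symm.sum_comp] at hm
  rw [← Equiv.ulift.symm.prod_comp, ← Equiv.ulift.symm.prod_comp]
  obtain ⟨k, hk⟩ := prime_dvd_of_prod_extremalWeight_pow_eq_one (m := fun i => m ⟨i⟩) hp hpn hχ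
    (by rw [← hm] at he; exact he.trans_lt hd)
  simp only [Fin.prod_univ_three, Equiv.ulift_symm_apply, y, Matrix.cons_val_zero,
    Matrix.cons_val_one, Matrix.cons_val, Pi.one_apply, one_pow, one_mul]
  rw [hk, pow_mul, hζ.pow_eq_one, one_pow]

end LowerBound

/-- The characters of `ZMod N × ZMod n` form a group generated by two elements. -/
lemma exists_generators_of_characters (N n : ℕ) [NeZero N] [NeZero n] :
    ∃ e f : Multiplicative (ZMod N) × Multiplicative (ZMod n) →* ℂˣ,
      ∀ χ, ∃ x y : ℤ, χ = e ^ x * f ^ y := by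
  obtain ⟨E⟩ := CommGroup.monoidHom_mulEquiv_of_hasEnoughRootsOfUnity
    (Multiplicative (ZMod N) × Multiplicative (ZMod n)) ℂ
  refine ⟨E.symm (.ofAdd 1, 1), E.symm (1, .ofAdd 1), fun χ => ?_⟩
  refine ⟨(E χ).1.toAdd.val, (E χ).2.toAdd.val, E.injective ?_⟩
  simp only [map_mul, map_zpow, MulEquiv.apply_symm_apply]
  ext <;> simp

theorem theorem1p1 (l n p : ℕ) (hl : 0 < l) (hn : 0 < n)
    (hp : IsLeast {q : ℕ | q.Prime ∧ q ∣ n} p) :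
    sepNoetherNumber.{0, v} (Multiplicative (ZMod (l * n)) × Multiplicative (ZMod n)) =
      ((l * n + n / p : ℕ) : ℕ∞) := by
  have hN : 0 < l * n := Nat.mul_pos hl hn
  have : NeZero n := ⟨hn.ne'⟩
  have : NeZero (l * n) := ⟨hN.ne'⟩
  apply le_antisymm
  · obtain ⟨e, f, hef⟩ := exists_generators_of_characters (l * n) n
    refine iSup_le fun V => iSup_le fun _ => iSup_le fun _ => iSup_le fun _ => iSup_le fun ρ => ?_
    refine iInf_le_of_le (l * n + n / p) (iInf_le_of_le (Nat.add_pos_left hN _)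
      (iInf_le_of_le ?_ le_rfl))
    refine separatesOrbitsInDegree_add_div hn hN (dvd_mul_left n l) (by simp) (fun g => ?_) hp hef ρ
    refine Prod.ext ?_ ?_
    · exact Multiplicative.toAdd.injective (by simp)
    · exact Multiplicative.toAdd.injective (by simp)
  -- `ULift` places the three-dimensional example in the universe over which the supremum runs.
  · refine le_iSup_of_le (ULift.{v} (Fin 3) → ℂ) (le_iSup_of_le inferInstance
      (le_iSup_of_le inferInstance (le_iSup_of_le inferInstance (le_iSup_of_le
        (diagonalRep fun i : ULift.{v} (Fin 3) => extremalWeight (l * n) n p i.down) ?_))))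
    refine le_iInf fun d => le_iInf fun _ => le_iInf fun hd => ?_
    by_contra hlt
    exact not_separatesOrbitsInDegree_diagonalRep_extremalWeight hp.1.1 hp.1.2
      (by exact_mod_cast not_le.mp hlt) hd
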